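/- For $0<\alpha<1$, $t>0$ and $x\in\mathbb R$, let $$v_\alpha(t,x)=\frac1{2\pi}\int_{-\infty}^{\infty}e^{-i\omega x}\exp\!\left(-t|\omega|^{\alpha}e^{-\frac{i\pi}{2}\alpha\,\mathrm{sgn}(\omega)}\right)d\omega$$ be the one-sided $\alpha$-stable density (whose Laplace transform in $x$ is $e^{-tp^{\alpha}}$), and let $$h_{\alpha_1,\alpha_2}(t,x)=\int_0^x v_{\alpha_1}(t,y)\,v_{\alpha_2}(t,x-y)\,dy$$ be the two-scale one-sided density. Let ${}_1F_1(a;b;z)=\sum_{n\ge0}\frac{(a)_n}{(b)_n}\frac{z^n}{n!}$, with $(a)_n=a(a+1)\cdots(a+n-1)$, be the confluent hypergeometric function, and let $$D_\nu(z)=2^{\nu/2}e^{-z^2/4}\left[\frac{\sqrt{\pi}}{\Gamma(\frac{1-\nu}{2})}\,{}_1F_1\!\left(-\tfrac{\nu}{2};\tfrac12;\tfrac{z^2}{2}\right)-\frac{\sqrt{2\pi}\,z}{\Gamma(-\frac{\nu}{2})}\,{}_1F_1\!\left(\tfrac{1-\nu}{2};\tfrac32;\tfrac{z^2}{2}\right)\right]$$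 be the parabolic cylinder function, where $1/\Gamma$ is the entire reciprocal gamma function (equal to $0$ at the poles of $\Gamma$). Then for all $t>0$ and $x>0$ the integral defining $h_{\frac12,\frac13}(t,x)$ exists, $$h_{\frac12,\frac13}(t,x)=\sum_{r=0}^{\infty}\frac{(-t)^r}{r!}\,\frac{x^{-\frac r3-1}}{\Gamma(-\frac r3)}\,{}_1F_1\!\left(1+\tfrac r3;\tfrac12;-\tfrac{t^2}{4x}\right)+\sum_{r=0}^{\infty}\frac{(-t)^{r+1}}{r!}\,\frac{x^{-\frac r3-\frac32}}{\Gamma(-\frac r3-\frac12)}\,{}_1F_1\!\left(\tfrac r3+\tfrac32;\tfrac32;-\tfrac{t^2}{4x}\right),$$ and $$h_{\frac12,\frac13}(t,x)=\frac{e^{-t^2/(8x)}}{\sqrt{2\pi}\,x}\sum_{n=0}^{\infty}\frac{(-t)^n}{n!}\,(2x)^{-n/3}\,D_{1+\frac{2n}{3}}\!\left(\frac{t}{\sqrt{2x}}\right),$$ where all three series converge absolutely. -/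

import Mathlib

noncomputable section

/-- The stable density `v_{α,β,γ}(t,x)`, i.e. the inverse Fourier transform
`(2π)⁻¹ ∫ e^{-iωx} exp(-t γ |ω|^α e^{(iπ/2) β sgn ω}) dω`.
The integrand at `-ω` is the complex conjugate of the integrand at `ω`, so that the integral is
real. It converges absolutely for `0 < α < 1`, `|β| ≤ α` and `γ, t > 0`. -/
def stableDensity (α β γ t x : ℝ) : ℝ :=
  (2 * Real.pi)⁻¹ * (∫ ω : ℝ, Complex.exp (-(Complex.I * (ω * x : ℝ))) *
    Complex.exp (-((t * γ * |ω| ^ α : ℝ) *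
      Complex.exp (Complex.I * (Real.pi / 2 * β * Real.sign ω : ℝ))))).re

/-- The one-sided stable density `v_α(t,x) = v_{α,-α,1}(t,x)`. -/
def oneSidedDensity (α t x : ℝ) : ℝ :=
  stableDensity α (-α) 1 t x

/-- The two-scale one-sided density
`h_{α₁,α₂}(t,x) = ∫₀ˣ v_{α₁}(t,y) v_{α₂}(t,x-y) dy`. -/
def twoScaleDensity (α₁ α₂ t x : ℝ) : ℝ :=
  ∫ y in (0 : ℝ)..x, oneSidedDensity α₁ t y * oneSidedDensity α₂ t (x - y)

/-- The confluent hypergeometric function `₁F₁(a; b; z) = ∑ₙ (a)ₙ / (b)ₙ zⁿ / n!`, for `b` not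
a nonpositive integer. Mathlib's regularized series has `Γ(b + n) = Γ(b) (b)ₙ` in place of
`(b)ₙ`. -/
def oneFOne (a b z : ℂ) : ℂ :=
  Complex.Gamma b * Complex.regularizedHGFun {a} {b} z

/-- The parabolic cylinder function `D_ν(z)`. As `Complex.Gamma` is `0` at its poles,
`(Complex.Gamma s)⁻¹` is the entire reciprocal gamma function. -/
def parabolicCylinderD (ν z : ℂ) : ℂ :=
  2 ^ (ν / 2) * Complex.exp (-(z ^ 2 / 4)) *
    ((Real.sqrt Real.pi : ℝ) * (Complex.Gamma ((1 - ν) / 2))⁻¹ *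
        oneFOne (-(ν / 2)) (1 / 2) (z ^ 2 / 2)
      - (Real.sqrt (2 * Real.pi) : ℝ) * z * (Complex.Gamma (-(ν / 2)))⁻¹ *
        oneFOne ((1 - ν) / 2) (3 / 2) (z ^ 2 / 2))

/-- The `n`-th term of the series of parabolic cylinder functions. -/
def cylinderTerm (t x : ℝ) (n : ℕ) : ℂ :=
  ((-t) ^ n / (n.factorial : ℝ) * (2 * x) ^ (-((n : ℝ) / 3)) : ℝ) *
    parabolicCylinderD (1 + 2 * (n : ℂ) / 3) ((t / Real.sqrt (2 * x) : ℝ) : ℂ)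

/-- The `r`-th term of the first series of confluent hypergeometric functions. -/
def confluentTermA (t x : ℝ) (r : ℕ) : ℂ :=
  ((-t) ^ r / (r.factorial : ℝ) * x ^ (-((r : ℝ) / 3) - 1) * (Real.Gamma (-((r : ℝ) / 3)))⁻¹ : ℝ) *
    oneFOne (1 + (r : ℂ) / 3) (1 / 2) ((-(t ^ 2 / (4 * x)) : ℝ) : ℂ)

/-- The `r`-th term of the second series of confluent hypergeometric functions. -/
def confluentTermB (t x : ℝ) (r : ℕ) : ℂ :=
  ((-t) ^ (r + 1) / (r.factorial : ℝ) * x ^ (-((r : ℝ) / 3) - 3 / 2) *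
      (Real.Gamma (-((r : ℝ) / 3) - 1 / 2))⁻¹ : ℝ) *
    oneFOne ((r : ℂ) / 3 + 3 / 2) (3 / 2) ((-(t ^ 2 / (4 * x)) : ℝ) : ℂ)

end

noncomputable section

open MeasureTheory Set Filter Topology

/-! The characteristic function of v_α is exp(-t(-iω)^α). Fubini and Fourier inversion turn the
convolution over ℝ into the inverse transform of a product of two such factors
(`integral_invChar_mul_invChar`). Each density vanishes on the negative half-line, so only 0 ≤ y ≤ x
contributes (`twoScaleDensity_eq_invChar`).

For ω > 0 the product is a double power series in ω^(αk+βn). Damped by e^(-εω), it can be integrated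
term by term with Euler's integral; since α, β < 1 the result is summable uniformly in ε, and ε → 0
is allowed (`integral_Ioi_twoScaleChar`). Taking real parts, the reflection formula gives terms
proportional to x^(-s-1)/Γ(-s), s = αk+βn, for x > 0 (`hasSum_densityTerm`); for x < 0 every term
vanishes.

For α = 1/2, β = 1/3 and fixed n, raising k by 2 raises s by 1, so the even and the odd k sum to the
two ₁F₁ series. Kummer's transformation (`exp_neg_mul_oneFOne`) identifies the sum of both parts
with a multiple of D_{1+2n/3} (`const_mul_cylinderTerm`). -/

/-! ### Confluent hypergeometric series and Kummer's transformation -/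

theorem ascPochhammer_eval_ne_zero {b : ℂ} (hb : ∀ m : ℕ, b ≠ -m) (n : ℕ) :
    (ascPochhammer ℂ n).eval b ≠ 0 := by
  induction n with
  | zero => simp
  | succ n ih =>
    rw [ascPochhammer_succ_eval]
    refine mul_ne_zero ih fun h => hb n (by linear_combination h)

theorem ascPochhammer_succ_eval_left (n : ℕ) (b : ℂ) :
    (ascPochhammer ℂ (n + 1)).eval b = b * (ascPochhammer ℂ n).eval (b + 1) := by
  simp [ascPochhammer_succ_left, Polynomial.eval_comp]

/-- The `n`-th term of the confluent hypergeometric series. -/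
def oneFOneTerm (a b z : ℂ) (n : ℕ) : ℂ :=
  (ascPochhammer ℂ n).eval a / (ascPochhammer ℂ n).eval b * (z ^ n / n.factorial)

theorem oneFOneTerm_eq {b : ℂ} (hb : ∀ m : ℕ, b ≠ -m) (a z : ℂ) (n : ℕ) :
    oneFOneTerm a b z n =
      Complex.Gamma b * ((Complex.regularizedHGFunSeries {a} {b}) n fun _ => z) := by
  have hΓ : Complex.Gamma b ≠ 0 := Complex.Gamma_ne_zero hb
  have hp := ascPochhammer_eval_ne_zero hb n
  have hn : (n.factorial : ℂ) ≠ 0 := by exact_mod_cast n.factorial_ne_zero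
  simp only [oneFOneTerm, Complex.regularizedHGFunSeries, Complex.regularizedHGFunCoeff,
    FormalMultilinearSeries.ofScalars_apply_eq, Multiset.map_singleton, Multiset.prod_singleton,
    smul_eq_mul, ← Complex.Gamma_add_nat_div_Gamma_eq b hb]
  field_simp

theorem hasSum_oneFOneTerm {b : ℂ} (hb : ∀ m : ℕ, b ≠ -m) (a z : ℂ) :
    HasSum (oneFOneTerm a b z) (oneFOne a b z) := by
  have h : z ∈ Metric.eball 0 (Complex.regularizedHGFunSeries {a} {b}).radius := by
    rw [Complex.radius_regularizedHGFunSeries_eq_top (by simp)]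
    simp
  rw [funext (oneFOneTerm_eq hb a z)]
  exact ((Complex.regularizedHGFunSeries {a} {b}).hasSum h).mul_left _

/-- Chu–Vandermonde, the coefficient identity behind Kummer's transformation. Pascal's rule splits
the sum in two, one of them with both parameters raised by 1; hence the induction must keep a and b
general. -/
theorem sum_neg_one_pow_choose_mul_ascPochhammer_div (n : ℕ) :
    ∀ {a b : ℂ}, (∀ m : ℕ, b ≠ -m) →
    ∑ ij ∈ Finset.HasAntidiagonal.antidiagonal n, (n.choose ij.1 : ℂ) *
        ((-1) ^ ij.1 * ((ascPochhammer ℂ ij.1).eval a / (ascPochhammer ℂ ij.1).eval b)) =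
      (ascPochhammer ℂ n).eval (b - a) / (ascPochhammer ℂ n).eval b := by
  induction n with
  | zero => simp
  | succ n ih =>
    intro a b hb
    have hb' : ∀ m : ℕ, b + 1 ≠ -m := fun m h => hb (m + 1) (by push_cast; linear_combination h)
    have hb0 : b ≠ 0 := by simpa using hb 0
    have hbn : b + n ≠ 0 := fun h => hb n (by linear_combination h)
    have hp := ascPochhammer_eval_ne_zero hb n
    have hp' := ascPochhammer_eval_ne_zero hb' n
    have hbb : (ascPochhammer ℂ n).eval b * (b + n) = b * (ascPochhammer ℂ n).eval (b + 1) := by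
      rw [← ascPochhammer_succ_eval, ascPochhammer_succ_eval_left]
    have hsym : ∀ ij ∈ Finset.HasAntidiagonal.antidiagonal n, (n.choose ij.2 : ℂ) *
        ((-1) ^ (ij.1 + 1) * ((ascPochhammer ℂ (ij.1 + 1)).eval a /
          (ascPochhammer ℂ (ij.1 + 1)).eval b)) = -(a / b) * ((n.choose ij.1 : ℂ) *
        ((-1) ^ ij.1 * ((ascPochhammer ℂ ij.1).eval (a + 1) /
          (ascPochhammer ℂ ij.1).eval (b + 1)))) := by
      intro ij hij
      have hp1 := ascPochhammer_eval_ne_zero hb' ij.1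
      rw [← Nat.choose_symm_of_eq_add (Finset.HasAntidiagonal.mem_antidiagonal.mp hij).symm,
        ascPochhammer_succ_eval_left, ascPochhammer_succ_eval_left]
      field_simp
      ring
    rw [Finset.sum_antidiagonal_choose_succ_mul (fun i _ => (-1 : ℂ) ^ i *
      ((ascPochhammer ℂ i).eval a / (ascPochhammer ℂ i).eval b)), ih hb,
      Finset.sum_congr rfl hsym, ← Finset.mul_sum, ih hb', ascPochhammer_succ_eval,
      ascPochhammer_succ_eval, add_sub_add_right_eq_sub, hbb]
    field_simp
    linear_combination (ascPochhammer ℂ n).eval (b - a) * (-hbb)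

/-- Kummer's transformation. -/
theorem exp_neg_mul_oneFOne {b : ℂ} (hb : ∀ m : ℕ, b ≠ -m) (a z : ℂ) :
    Complex.exp (-z) * oneFOne a b z = oneFOne (b - a) b (-z) := by
  have hE : HasSum (fun n : ℕ => (-z) ^ n / n.factorial) (Complex.exp (-z)) := by
    rw [Complex.exp_eq_exp_ℂ]
    exact NormedSpace.expSeries_div_hasSum_exp (-z)
  have hF := hasSum_oneFOneTerm hb a z
  rw [mul_comm, ← hE.tsum_eq, ← hF.tsum_eq, ← (hasSum_oneFOneTerm hb (b - a) (-z)).tsum_eq,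
    tsum_mul_tsum_eq_tsum_sum_antidiagonal_of_summable_norm hF.summable.norm hE.summable.norm]
  congr 1
  funext n
  rw [oneFOneTerm, ← sum_neg_one_pow_choose_mul_ascPochhammer_div n hb, Finset.sum_mul]
  refine Finset.sum_congr rfl fun ij hij => ?_
  rw [Finset.HasAntidiagonal.mem_antidiagonal] at hij
  have h1 : (ij.1.factorial : ℂ) ≠ 0 := by exact_mod_cast ij.1.factorial_ne_zero
  have h2 : (ij.2.factorial : ℂ) ≠ 0 := by exact_mod_cast ij.2.factorial_ne_zero
  have h3 := ascPochhammer_eval_ne_zero hb ij.1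
  have h4 : (n.choose ij.1 : ℂ) * ij.1.factorial * ij.2.factorial = n.factorial := by
    rw [← hij]
    exact_mod_cast Nat.choose_symm_add (a := ij.1) (b := ij.2) ▸
      Nat.add_choose_mul_factorial_mul_factorial ij.1 ij.2
  have h5 : (n.factorial : ℂ) ≠ 0 := by exact_mod_cast n.factorial_ne_zero
  have h6 : z ^ ij.1 = (-1) ^ ij.1 * (-z) ^ ij.1 := by rw [← mul_pow]; simp
  have h7 : (-z) ^ n = (-z) ^ ij.1 * (-z) ^ ij.2 := by rw [← pow_add, hij]
  rw [oneFOneTerm, h6, h7]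
  field_simp
  linear_combination (-((ascPochhammer ℂ ij.1).eval a * z ^ ij.1 * z ^ ij.2 * (-1) ^ ij.1 *
    (-1) ^ ij.2)) * h4

/-! ### Characteristic functions -/

/-- The characteristic function `exp(-t (-iω)^α)` of the one-sided stable density. -/
def stableChar (α t ω : ℝ) : ℂ :=
  Complex.exp (-((t * 1 * |ω| ^ α : ℝ) *
    Complex.exp (Complex.I * (Real.pi / 2 * (-α) * Real.sign ω : ℝ))))

theorem stableChar_of_pos {ω : ℝ} (hω : 0 < ω) (α t : ℝ) :
    stableChar α t ω = Complex.exp (-(t : ℂ) * (ω ^ α : ℝ) *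
      Complex.exp (-(Complex.I * (Real.pi / 2 * α : ℝ)))) := by
  rw [stableChar, Real.sign_of_pos hω, abs_of_pos hω]
  congr 1
  push_cast
  ring_nf

theorem stableChar_neg (α t ω : ℝ) :
    stableChar α t (-ω) = (starRingEnd ℂ) (stableChar α t ω) := by
  simp only [stableChar, ← Complex.exp_conj, abs_neg, Real.sign_neg, map_neg, map_mul,
    Complex.conj_ofReal, Complex.conj_I, mul_neg, neg_mul, Complex.ofReal_neg]

theorem stableChar_zero_left (α ω : ℝ) : stableChar α 0 ω = 1 := by
  simp [stableChar]

theorem norm_stableChar {α : ℝ} (hα : α ≠ 0) (t ω : ℝ) :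
    ‖stableChar α t ω‖ = Real.exp (-(t * Real.cos (Real.pi / 2 * α)) * |ω| ^ α) := by
  rw [stableChar, Complex.norm_exp]
  congr 1
  rw [mul_comm Complex.I, Complex.neg_re, Complex.re_ofReal_mul, Complex.exp_ofReal_mul_I_re]
  rcases lt_trichotomy ω 0 with h | h | h
  · rw [Real.sign_of_neg h, show Real.pi / 2 * -α * -1 = Real.pi / 2 * α by ring]; ring
  · simp [h, Real.zero_rpow hα]
  · rw [Real.sign_of_pos h, show Real.pi / 2 * -α * 1 = -(Real.pi / 2 * α) by ring, Real.cos_neg]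
    ring

theorem cos_half_pi_mul_pos {α : ℝ} (h0 : 0 < α) (h1 : α < 1) :
    0 < Real.cos (Real.pi / 2 * α) :=
  Real.cos_pos_of_mem_Ioo ⟨by nlinarith [Real.pi_pos], by nlinarith [Real.pi_pos]⟩

theorem norm_stableChar_le_one {α t : ℝ} (h0 : 0 < α) (h1 : α < 1) (ht : 0 ≤ t) (ω : ℝ) :
    ‖stableChar α t ω‖ ≤ 1 := by
  rw [norm_stableChar h0.ne', Real.exp_le_one_iff]
  have := cos_half_pi_mul_pos h0 h1
  have := Real.rpow_nonneg (abs_nonneg ω) α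
  rw [neg_mul, neg_nonpos]
  positivity

theorem continuous_stableChar {α : ℝ} (h0 : 0 < α) (t : ℝ) : Continuous (stableChar α t) := by
  -- The sign function jumps at 0, but it is harmless where |ω|^α vanishes: splitting into positive
  -- and negative parts of ω removes it.
  have h : stableChar α t = fun ω : ℝ => Complex.exp (-(t * (((max ω 0) ^ α : ℝ) *
      Complex.exp (Complex.I * (Real.pi / 2 * (-α) : ℝ)) + ((max (-ω) 0) ^ α : ℝ) *
      Complex.exp (Complex.I * (Real.pi / 2 * α : ℝ))))) := by
    funext ω
    rw [stableChar]
    rcases lt_trichotomy ω 0 with h | h | h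
    · rw [Real.sign_of_neg h, max_eq_right h.le, max_eq_left (by linarith), abs_of_neg h,
        Real.zero_rpow h0.ne']
      push_cast
      ring_nf
    · simp [h, Real.zero_rpow h0.ne']
    · rw [Real.sign_of_pos h, max_eq_left h.le, max_eq_right (by linarith), abs_of_pos h,
        Real.zero_rpow h0.ne']
      push_cast
      ring_nf
  rw [h]
  have h1 : Continuous fun ω : ℝ => (max ω 0) ^ α :=
    (by fun_prop : Continuous fun ω : ℝ => max ω 0).rpow_const fun _ => Or.inr h0.le
  have h2 : Continuous fun ω : ℝ => (max (-ω) 0) ^ α :=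
    (by fun_prop : Continuous fun ω : ℝ => max (-ω) 0).rpow_const fun _ => Or.inr h0.le
  fun_prop

theorem integrable_stableChar {α t : ℝ} (h0 : 0 < α) (h1 : α < 1) (ht : 0 < t) :
    Integrable (stableChar α t) := by
  have hc := mul_pos ht (cos_half_pi_mul_pos h0 h1)
  have h := integrableOn_rpow_mul_exp_neg_mul_rpow (s := 0) (by norm_num) h0 hc
  have hI : IntegrableOn (stableChar α t) (Ioi 0) := by
    refine Integrable.mono' h (continuous_stableChar h0 t).aestronglyMeasurable ?_
    refine (ae_restrict_iff' measurableSet_Ioi).mpr (Eventually.of_forall fun ω hω => ?_)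
    rw [norm_stableChar h0.ne', abs_of_pos hω]
    simp
  have hI' : IntegrableOn (stableChar α t) (Iic 0) := by
    rw [← integrableOn_Ici_iff_integrableOn_Ioi] at hI
    refine Integrable.congr' (f := fun ω => stableChar α t (-ω)) ?_
      (continuous_stableChar h0 t).aestronglyMeasurable
      (Eventually.of_forall fun ω => by rw [stableChar_neg, RCLike.norm_conj])
    have := hI.comp_neg
    rw [IntegrableOn] at this
    simpa using this
  rw [← integrableOn_univ, ← Iic_union_Ioi (a := (0 : ℝ))]
  exact hI'.union hI

/-- The characteristic function of the two-scale one-sided density. -/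
def twoScaleChar (α β a b ω : ℝ) : ℂ := stableChar α a ω * stableChar β b ω

theorem twoScaleChar_neg (α β a b ω : ℝ) :
    twoScaleChar α β a b (-ω) = (starRingEnd ℂ) (twoScaleChar α β a b ω) := by
  simp [twoScaleChar, stableChar_neg]

theorem continuous_twoScaleChar {α β : ℝ} (hα : 0 < α) (hβ : 0 < β) (a b : ℝ) :
    Continuous (twoScaleChar α β a b) :=
  (continuous_stableChar hα a).mul (continuous_stableChar hβ b)

theorem integrable_twoScaleChar {α β a b : ℝ} (hα : 0 < α) (hα' : α < 1) (hβ : 0 < β)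
    (hβ' : β < 1) (ha : 0 < a) (hb : 0 ≤ b) : Integrable (twoScaleChar α β a b) :=
  (integrable_stableChar hα hα' ha).mul_bdd (c := 1)
    (continuous_stableChar hβ b).aestronglyMeasurable
    (Eventually.of_forall (norm_stableChar_le_one hβ hβ' hb))

/-! ### Inverse transform and reduction to the half-line -/

/-- The inverse Fourier transform with the normalization of probability theory. -/
def invChar (φ : ℝ → ℂ) (x : ℝ) : ℂ :=
  ((2 * Real.pi : ℝ) : ℂ)⁻¹ * ∫ ω : ℝ, Complex.exp (-(Complex.I * (ω * x : ℝ))) * φ ω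

theorem oneSidedDensity_eq_re (α t x : ℝ) :
    oneSidedDensity α t x = (invChar (stableChar α t) x).re := by
  rw [invChar, ← Complex.ofReal_inv, Complex.re_ofReal_mul]
  rfl

theorem integrable_exp_mul {φ : ℝ → ℂ} (hφ : Integrable φ) (x : ℝ) :
    Integrable fun ω : ℝ => Complex.exp (-(Complex.I * (ω * x : ℝ))) * φ ω :=
  hφ.bdd_mul (c := 1) (by fun_prop) (Eventually.of_forall fun ω => by
    rw [mul_comm Complex.I, ← neg_mul, ← Complex.ofReal_neg, Complex.norm_exp_ofReal_mul_I])

/-- By Hermitian symmetry the negative half-line contributes the conjugate of the positive one, so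
expansions are needed only for ω > 0. -/
theorem invChar_eq_half {φ : ℝ → ℂ} (hφ : Integrable φ)
    (hsymm : ∀ ω, φ (-ω) = (starRingEnd ℂ) (φ ω)) (x : ℝ) :
    invChar φ x = ((Real.pi⁻¹ *
      (∫ ω in Ioi (0 : ℝ), Complex.exp (-(Complex.I * (ω * x : ℝ))) * φ ω).re : ℝ) : ℂ) := by
  have hI := integrable_exp_mul hφ x
  set f : ℝ → ℂ := fun ω => Complex.exp (-(Complex.I * (ω * x : ℝ))) * φ ω with hf
  have hneg : ∀ ω, f (-ω) = (starRingEnd ℂ) (f ω) := fun ω => by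
    simp [hf, hsymm, ← Complex.exp_conj]
  have h1 : ∫ ω in Iic (0 : ℝ), f ω = (starRingEnd ℂ) (∫ ω in Ioi (0 : ℝ), f ω) := by
    rw [← integral_conj, ← neg_zero, ← integral_comp_neg_Ioi, neg_zero]
    simp only [← hneg]
  rw [invChar, ← intervalIntegral.integral_Iic_add_Ioi (b := 0) hI.integrableOn hI.integrableOn,
    h1, add_comm, Complex.add_conj]
  push_cast
  field_simp

/-! ### Euler's integral in the right half-plane -/

theorem integrableOn_rpow_mul_exp_neg_mul {s c : ℝ} (hs : -1 < s) (hc : 0 < c) :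
    IntegrableOn (fun ω : ℝ => ω ^ s * Real.exp (-(c * ω))) (Ioi 0) := by
  simpa using integrableOn_rpow_mul_exp_neg_mul_rpow (p := 1) hs one_pos hc

theorem norm_rpow_mul_cexp {ω : ℝ} (hω : 0 < ω) (s : ℝ) (r : ℂ) :
    ‖((ω ^ s : ℝ) : ℂ) * Complex.exp (-(r * ω))‖ = ω ^ s * Real.exp (-(r.re * ω)) := by
  rw [norm_mul, Complex.norm_real, Complex.norm_exp, Real.norm_of_nonneg (by positivity),
    Complex.neg_re, Complex.re_mul_ofReal]

theorem aestronglyMeasurable_rpow_mul_cexp (s : ℝ) (r : ℂ) :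
    AEStronglyMeasurable (fun ω : ℝ => ((ω ^ s : ℝ) : ℂ) * Complex.exp (-(r * ω)))
      (volume.restrict (Ioi 0)) := by
  fun_prop

theorem integrableOn_rpow_mul_cexp {s : ℝ} (hs : -1 < s) {r : ℂ} (hr : 0 < r.re) :
    IntegrableOn (fun ω : ℝ => ((ω ^ s : ℝ) : ℂ) * Complex.exp (-(r * ω))) (Ioi 0) := by
  refine Integrable.mono' (integrableOn_rpow_mul_exp_neg_mul hs hr)
    (aestronglyMeasurable_rpow_mul_cexp s r) ?_
  exact (ae_restrict_iff' measurableSet_Ioi).mpr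
    (Eventually.of_forall fun ω hω => (norm_rpow_mul_cexp hω s r).le)

theorem differentiableAt_integral_rpow_mul_cexp {s : ℝ} (hs : -1 < s) {r : ℂ} (hr : 0 < r.re) :
    DifferentiableAt ℂ
      (fun z : ℂ => ∫ ω in Ioi (0 : ℝ), ((ω ^ s : ℝ) : ℂ) * Complex.exp (-(z * ω))) r := by
  -- On this half-plane one integrable bound serves for all derivatives.
  have hnhds : {z : ℂ | r.re / 2 < z.re} ∈ 𝓝 r :=
    (isOpen_lt continuous_const Complex.continuous_re).mem_nhds (by simpa using by linarith)
  refine (hasDerivAt_integral_of_dominated_loc_of_deriv_le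
    (F' := fun z ω => ((ω ^ s : ℝ) : ℂ) * (Complex.exp (-(z * ω)) * -(ω : ℂ)))
    (bound := fun ω => ω ^ (s + 1) * Real.exp (-(r.re / 2 * ω))) hnhds
    (Eventually.of_forall fun z => aestronglyMeasurable_rpow_mul_cexp s z)
    (integrableOn_rpow_mul_cexp hs hr) ?_ ?_
    (integrableOn_rpow_mul_exp_neg_mul (by linarith) (half_pos hr)) ?_).2.differentiableAt
  · fun_prop
  · refine (ae_restrict_iff' measurableSet_Ioi).mpr (Eventually.of_forall fun ω hω z hz => ?_)
    have hω' : (0 : ℝ) < ω := hω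
    have hz' : r.re / 2 < z.re := hz
    rw [← mul_assoc, norm_mul, norm_rpow_mul_cexp hω', norm_neg, Complex.norm_real,
      Real.norm_of_nonneg hω'.le, Real.rpow_add_one hω'.ne', mul_right_comm]
    gcongr
  · refine Eventually.of_forall fun ω z _ => HasDerivAt.const_mul _ (HasDerivAt.cexp ?_)
    have h := ((hasDerivAt_id z).mul_const (ω : ℂ)).neg
    rw [one_mul] at h
    exact h

/-- Euler's integral with a complex rate. -/
theorem integral_rpow_mul_cexp {s : ℝ} (hs : -1 < s) {r : ℂ} (hr : 0 < r.re) :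
    ∫ ω in Ioi (0 : ℝ), ((ω ^ s : ℝ) : ℂ) * Complex.exp (-(r * ω)) =
      (Real.Gamma (s + 1) : ℂ) * r ^ (-((s + 1 : ℝ) : ℂ)) := by
  set U : Set ℂ := {z : ℂ | 0 < z.re} with hU
  have hUo : IsOpen U := isOpen_lt continuous_const Complex.continuous_re
  have hUc : IsPreconnected U := (convex_halfSpace_re_gt 0).isPreconnected
  have hf : AnalyticOnNhd ℂ
      (fun z : ℂ => ∫ ω in Ioi (0 : ℝ), ((ω ^ s : ℝ) : ℂ) * Complex.exp (-(z * ω))) U :=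
    DifferentiableOn.analyticOnNhd (fun z hz =>
      (differentiableAt_integral_rpow_mul_cexp hs hz).differentiableWithinAt) hUo
  have hg : AnalyticOnNhd ℂ
      (fun z : ℂ => (Real.Gamma (s + 1) : ℂ) * z ^ (-((s + 1 : ℝ) : ℂ))) U :=
    DifferentiableOn.analyticOnNhd (fun z hz =>
      ((differentiableAt_id.cpow_const (Or.inl hz)).const_mul _).differentiableWithinAt) hUo
  -- Identity theorem: both sides are analytic for Re z > 0 and agree at real c > 1, which
  -- accumulate at 1.
  refine hf.eqOn_of_preconnected_of_frequently_eq hg hUc (z₀ := 1) (by simp [hU]) ?_ hr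
  have hlim : Tendsto (fun c : ℝ => (c : ℂ)) (𝓝[>] 1) (𝓝[≠] 1) := by
    refine tendsto_nhdsWithin_iff.mpr ⟨?_, ?_⟩
    · exact (Complex.continuous_ofReal.tendsto' 1 1 Complex.ofReal_one).mono_left
        nhdsWithin_le_nhds
    · filter_upwards [self_mem_nhdsWithin] with c hc
      have : (1 : ℝ) < c := hc
      simpa using this.ne'
  refine hlim.frequently (Eventually.frequently ?_)
  filter_upwards [self_mem_nhdsWithin] with c hc
  have hc0 : (0 : ℝ) < c := one_pos.trans hc
  have h := Real.integral_rpow_mul_exp_neg_mul_Ioi (a := s + 1) (by linarith) hc0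
  rw [one_div, Real.inv_rpow hc0.le, ← Real.rpow_neg hc0.le, mul_comm, add_sub_cancel_right] at h
  rw [← Complex.ofReal_neg, ← Complex.ofReal_cpow hc0.le, ← Complex.ofReal_mul, ← h,
    ← integral_complex_ofReal]
  congr 1
  funext ω
  push_cast
  rfl

/-! ### The double exponential series and its summability -/

theorem Complex.hasSum_exp_mul_exp (x y : ℂ) :
    HasSum (fun p : ℕ × ℕ => x ^ p.1 / (p.1.factorial : ℂ) * (y ^ p.2 / (p.2.factorial : ℂ)))
      (Complex.exp x * Complex.exp y) := by
  let f : ℂ → ℕ → ℂ := fun z n => z ^ n / (n.factorial : ℂ)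
  have h : ∀ z : ℂ, HasSum (f z) (Complex.exp z) := fun z => by
    rw [Complex.exp_eq_exp_ℂ]
    exact NormedSpace.expSeries_div_hasSum_exp z
  have hm : Summable fun p : ℕ × ℕ => f x p.1 * f y p.2 :=
    summable_mul_of_summable_norm (h x).summable.norm (h y).summable.norm
  exact HasSum.mul (f := f x) (g := f y) (h x) (h y) hm

theorem Real.hasSum_exp_mul_exp (x y : ℝ) :
    HasSum (fun p : ℕ × ℕ => x ^ p.1 / (p.1.factorial : ℝ) * (y ^ p.2 / (p.2.factorial : ℝ)))
      (Real.exp x * Real.exp y) := by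
  have h := Complex.hasSum_exp_mul_exp x y
  rw [← Complex.hasSum_ofReal]
  exact_mod_cast h

/-- A power with exponent below 1 is sublinear at infinity; on the bounded remainder a constant
suffices. -/
theorem exists_mul_rpow_le {α : ℝ} (h1 : α < 1) (h0 : 0 < α) {c ε : ℝ} (hc : 0 ≤ c)
    (hε : 0 < ε) : ∃ K, ∀ ω : ℝ, 0 < ω → c * ω ^ α ≤ ε * ω + K := by
  have h := ((tendsto_rpow_neg_atTop (sub_pos.mpr h1)).const_mul c)
  rw [mul_zero] at h
  obtain ⟨M, hM⟩ := eventually_atTop.mp (h.eventually (gt_mem_nhds hε))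
  refine ⟨c * (max M 0) ^ α, fun ω hω => ?_⟩
  have hK : 0 ≤ c * (max M 0) ^ α := by positivity
  rcases le_total M ω with h | h
  · have := hM ω h
    have e : ω ^ α = ω ^ (-(1 - α)) * ω := by
      rw [← Real.rpow_add_one hω.ne']; ring_nf
    rw [e, ← mul_assoc]
    nlinarith
  · have : c * ω ^ α ≤ c * (max M 0) ^ α := by gcongr; exact le_max_of_le_left h
    nlinarith

theorem integrableOn_exp_rpow_add_rpow {α β a b ε : ℝ} (hα : 0 < α) (hα' : α < 1) (hβ : 0 < β)
    (hβ' : β < 1) (ha : 0 ≤ a) (hb : 0 ≤ b) (hε : 0 < ε) :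
    IntegrableOn (fun ω : ℝ => Real.exp (a * ω ^ α) * Real.exp (b * ω ^ β) *
      Real.exp (-(ε * ω))) (Ioi 0) := by
  -- Each power may consume ε/4 of the decay, leaving ε/2.
  obtain ⟨K, hK⟩ := exists_mul_rpow_le hα' hα ha (by positivity : 0 < ε / 4)
  obtain ⟨L, hL⟩ := exists_mul_rpow_le hβ' hβ hb (by positivity : 0 < ε / 4)
  have h := (integrableOn_rpow_mul_exp_neg_mul (s := 0) (by norm_num) (half_pos hε)).const_mul
    (Real.exp (K + L))
  refine Integrable.mono' h (by fun_prop) ?_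
  refine (ae_restrict_iff' measurableSet_Ioi).mpr (Eventually.of_forall fun ω hω => ?_)
  rw [Real.norm_of_nonneg (by positivity), Real.rpow_zero, one_mul, ← Real.exp_add,
    ← Real.exp_add, ← Real.exp_add]
  refine Real.exp_le_exp.mpr ?_
  linarith [hK ω hω, hL ω hω]

/-- The exponents of the double series. -/
def scaleExp (α β : ℝ) (p : ℕ × ℕ) : ℝ := α * p.1 + β * p.2

theorem scaleExp_nonneg {α β : ℝ} (hα : 0 < α) (hβ : 0 < β) (p : ℕ × ℕ) :
    0 ≤ scaleExp α β p := by
  unfold scaleExp; positivity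

theorem rpow_scaleExp {ω : ℝ} (hω : 0 < ω) (α β : ℝ) (p : ℕ × ℕ) :
    ω ^ scaleExp α β p = (ω ^ α) ^ p.1 * (ω ^ β) ^ p.2 := by
  rw [scaleExp, Real.rpow_add hω, Real.rpow_mul_natCast hω.le, Real.rpow_mul_natCast hω.le]

/-- The coefficients of the double exponential series. -/
def expCoeff (a b : ℝ) (p : ℕ × ℕ) : ℝ :=
  a ^ p.1 / (p.1.factorial : ℝ) * (b ^ p.2 / (p.2.factorial : ℝ))

theorem abs_expCoeff_neg {a b : ℝ} (ha : 0 ≤ a) (hb : 0 ≤ b) (p : ℕ × ℕ) :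
    |expCoeff (-a) (-b) p| = expCoeff a b p := by
  simp [expCoeff, abs_mul, abs_div, abs_of_nonneg ha, abs_of_nonneg hb]

theorem integral_rpow_mul_exp {s ε : ℝ} (hs : -1 < s) (hε : 0 < ε) :
    ∫ ω in Ioi (0 : ℝ), ω ^ s * Real.exp (-(ε * ω)) =
      Real.Gamma (s + 1) * ε ^ (-(s + 1)) := by
  have h := Real.integral_rpow_mul_exp_neg_mul_Ioi (a := s + 1) (by linarith) hε
  rwa [one_div, Real.inv_rpow hε.le, ← Real.rpow_neg hε.le, mul_comm (_ ^ _),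
    add_sub_cancel_right] at h

/-- The source of all absolute convergence: the terms are nonnegative, and a finite partial sum is
the integral of a partial sum of the double exponential, hence at most ∫ exp(aω^α + bω^β - εω) dω.
-/
theorem summable_expCoeff_mul_Gamma {α β a b ε : ℝ} (hα : 0 < α) (hα' : α < 1) (hβ : 0 < β)
    (hβ' : β < 1) (ha : 0 ≤ a) (hb : 0 ≤ b) (hε : 0 < ε) :
    Summable fun p : ℕ × ℕ => expCoeff a b p *
      (Real.Gamma (scaleExp α β p + 1) * ε ^ (-(scaleExp α β p + 1))) := by
  have hs : ∀ p, -1 < scaleExp α β p := fun p => by linarith [scaleExp_nonneg hα hβ p]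
  have hpos : ∀ p, 0 ≤ expCoeff a b p := fun p => by unfold expCoeff; positivity
  have hint : ∀ p, IntegrableOn (fun ω : ℝ =>
      expCoeff a b p * (ω ^ scaleExp α β p * Real.exp (-(ε * ω)))) (Ioi 0) := fun p =>
    (integrableOn_rpow_mul_exp_neg_mul (hs p) hε).const_mul _
  refine summable_of_sum_le (c := ∫ ω in Ioi (0 : ℝ), Real.exp (a * ω ^ α) *
    Real.exp (b * ω ^ β) * Real.exp (-(ε * ω))) (fun p => ?_) fun u => ?_
  · have : 0 < Real.Gamma (scaleExp α β p + 1) := Real.Gamma_pos_of_pos (by linarith [hs p])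
    have := hpos p
    simp only [Pi.zero_apply]
    positivity
  · have e : ∀ p ∈ u, expCoeff a b p *
        (Real.Gamma (scaleExp α β p + 1) * ε ^ (-(scaleExp α β p + 1))) =
        ∫ ω in Ioi (0 : ℝ), expCoeff a b p * (ω ^ scaleExp α β p * Real.exp (-(ε * ω))) :=
      fun p _ => by rw [integral_const_mul, integral_rpow_mul_exp (hs p) hε]
    rw [Finset.sum_congr rfl e, ← integral_finsetSum _ fun p _ => hint p]
    refine setIntegral_mono_on (integrable_finsetSum _ fun p _ => hint p)
      (integrableOn_exp_rpow_add_rpow hα hα' hβ hβ' ha hb hε) measurableSet_Ioi fun ω hω => ?_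
    have hω' : (0 : ℝ) < ω := hω
    have h := Real.hasSum_exp_mul_exp (a * ω ^ α) (b * ω ^ β)
    simp only [← mul_assoc]
    rw [← Finset.sum_mul]
    gcongr
    refine le_trans (le_of_eq (Finset.sum_congr rfl fun p _ => ?_))
      (sum_le_hasSum u (fun p _ => by positivity) h)
    rw [rpow_scaleExp hω', expCoeff, mul_pow, mul_pow]
    ring

/-! ### Termwise integration and removal of the damping -/

/-- The coefficients of the expansion of `twoScaleChar` on the positive half-line. -/
def charCoeff (α β a b : ℝ) (p : ℕ × ℕ) : ℂ :=
  (expCoeff (-a) (-b) p : ℂ) *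
    Complex.exp (-(Complex.I * (Real.pi / 2 * scaleExp α β p : ℝ)))

theorem norm_charCoeff {a b : ℝ} (ha : 0 ≤ a) (hb : 0 ≤ b) (α β : ℝ) (p : ℕ × ℕ) :
    ‖charCoeff α β a b p‖ = expCoeff a b p := by
  rw [charCoeff, norm_mul, Complex.norm_real, Real.norm_eq_abs, abs_expCoeff_neg ha hb,
    mul_comm Complex.I, ← neg_mul, ← Complex.ofReal_neg, Complex.norm_exp_ofReal_mul_I, mul_one]

theorem hasSum_twoScaleChar {ω : ℝ} (hω : 0 < ω) (α β a b : ℝ) :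
    HasSum (fun p => charCoeff α β a b p * (ω ^ scaleExp α β p : ℝ))
      (twoScaleChar α β a b ω) := by
  rw [twoScaleChar, stableChar_of_pos hω, stableChar_of_pos hω]
  refine (Complex.hasSum_exp_mul_exp _ _).congr_fun fun p => ?_
  have e : Complex.exp (-(Complex.I * (Real.pi / 2 * scaleExp α β p : ℝ))) =
      Complex.exp (-(Complex.I * (Real.pi / 2 * α : ℝ))) ^ p.1 *
        Complex.exp (-(Complex.I * (Real.pi / 2 * β : ℝ))) ^ p.2 := by
    rw [← Complex.exp_nat_mul, ← Complex.exp_nat_mul, ← Complex.exp_add, scaleExp]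
    congr 1
    push_cast
    ring
  rw [charCoeff, e, rpow_scaleExp hω, expCoeff]
  push_cast
  rw [mul_pow, mul_pow, mul_pow, mul_pow]
  ring

theorem integral_damped_twoScaleChar {α β a b : ℝ} (hα : 0 < α) (hα' : α < 1) (hβ : 0 < β)
    (hβ' : β < 1) (ha : 0 ≤ a) (hb : 0 ≤ b) {r : ℂ} (hr : 0 < r.re) :
    ∫ ω in Ioi (0 : ℝ), Complex.exp (-(r * ω)) * twoScaleChar α β a b ω =
      ∑' p, charCoeff α β a b p * ((Real.Gamma (scaleExp α β p + 1) : ℂ) *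
        r ^ (-((scaleExp α β p + 1 : ℝ) : ℂ))) := by
  have hs : ∀ p, -1 < scaleExp α β p := fun p => by linarith [scaleExp_nonneg hα hβ p]
  have h := hasSum_integral_of_summable_integral_norm (μ := volume.restrict (Ioi (0 : ℝ)))
    (F := fun p (ω : ℝ) => charCoeff α β a b p *
      (((ω ^ scaleExp α β p : ℝ) : ℂ) * Complex.exp (-(r * ω))))
    (fun p => (integrableOn_rpow_mul_cexp (hs p) hr).const_mul _) ?_
  · have e : ∫ ω in Ioi (0 : ℝ), Complex.exp (-(r * ω)) * twoScaleChar α β a b ω =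
        ∫ ω in Ioi (0 : ℝ), ∑' p, charCoeff α β a b p *
          (((ω ^ scaleExp α β p : ℝ) : ℂ) * Complex.exp (-(r * ω))) := by
      refine setIntegral_congr_fun measurableSet_Ioi fun ω hω => ?_
      simp only [← mul_assoc]
      rw [tsum_mul_right, (hasSum_twoScaleChar hω α β a b).tsum_eq, mul_comm]
    rw [e, ← h.tsum_eq]
    congr 1
    funext p
    rw [integral_const_mul, integral_rpow_mul_cexp (hs p) hr]
  · refine (summable_expCoeff_mul_Gamma hα hα' hβ hβ' ha hb hr).congr fun p => ?_
    rw [← integral_rpow_mul_exp (hs p) hr, ← integral_const_mul]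
    refine setIntegral_congr_fun measurableSet_Ioi fun ω hω => ?_
    rw [norm_mul, norm_rpow_mul_cexp hω, norm_charCoeff ha hb]

/-- Let r = ε + ix tend to ix. The integrals are dominated by the norm of the characteristic
function, the series by `summable_expCoeff_mul_Gamma` with rate |x|, since |ε + ix| ≥ |x|. -/
theorem integral_Ioi_twoScaleChar {α β a b : ℝ} (hα : 0 < α) (hα' : α < 1) (hβ : 0 < β)
    (hβ' : β < 1) (ha : 0 < a) (hb : 0 ≤ b) {x : ℝ} (hx : x ≠ 0) :
    ∫ ω in Ioi (0 : ℝ), Complex.exp (-(Complex.I * (ω * x : ℝ))) * twoScaleChar α β a b ω =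
      ∑' p, charCoeff α β a b p * ((Real.Gamma (scaleExp α β p + 1) : ℂ) *
        (x * Complex.I) ^ (-((scaleExp α β p + 1 : ℝ) : ℂ))) := by
  have hint := (integrable_twoScaleChar hα hα' hβ hβ' ha hb).integrableOn (s := Ioi 0)
  have hcont := continuous_twoScaleChar hα hβ a b
  have hlim : Tendsto (fun ε : ℝ => (ε : ℂ) + x * Complex.I) (𝓝[>] 0) (𝓝 (x * Complex.I)) :=
    (Continuous.tendsto' (by fun_prop) 0 _ (by simp)).mono_left nhdsWithin_le_nhds
  have hL : Tendsto (fun ε : ℝ => ∫ ω in Ioi (0 : ℝ),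
      Complex.exp (-(((ε : ℂ) + x * Complex.I) * ω)) * twoScaleChar α β a b ω) (𝓝[>] 0)
      (𝓝 (∫ ω in Ioi (0 : ℝ),
        Complex.exp (-(Complex.I * (ω * x : ℝ))) * twoScaleChar α β a b ω)) := by
    refine tendsto_integral_filter_of_dominated_convergence
      (fun ω => ‖twoScaleChar α β a b ω‖) ?_ ?_ hint.norm ?_
    · exact Eventually.of_forall fun ε => by fun_prop
    · filter_upwards [self_mem_nhdsWithin] with ε hε
      refine (ae_restrict_iff' measurableSet_Ioi).mpr (Eventually.of_forall fun ω hω => ?_)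
      rw [norm_mul, Complex.norm_exp]
      refine mul_le_of_le_one_left (norm_nonneg _) (Real.exp_le_one_iff.mpr ?_)
      have := mul_pos (mem_Ioi.mp hε) (mem_Ioi.mp hω)
      simpa using this.le
    · refine Eventually.of_forall fun ω => Tendsto.mul_const _ ?_
      refine (Continuous.tendsto' (by fun_prop) 0 _ ?_).mono_left nhdsWithin_le_nhds
      push_cast
      ring_nf
  have hR : Tendsto (fun ε : ℝ => ∑' p, charCoeff α β a b p *
      ((Real.Gamma (scaleExp α β p + 1) : ℂ) *
        ((ε : ℂ) + x * Complex.I) ^ (-((scaleExp α β p + 1 : ℝ) : ℂ)))) (𝓝[>] 0)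
      (𝓝 (∑' p, charCoeff α β a b p * ((Real.Gamma (scaleExp α β p + 1) : ℂ) *
        (x * Complex.I) ^ (-((scaleExp α β p + 1 : ℝ) : ℂ))))) := by
    refine tendsto_tsum_of_dominated_convergence
      (summable_expCoeff_mul_Gamma hα hα' hβ hβ' ha.le hb (abs_pos.mpr hx)) (fun p => ?_) ?_
    · refine Tendsto.const_mul _ (Tendsto.const_mul _ ?_)
      have hmem : (x * Complex.I : ℂ) ∈ Complex.slitPlane := Or.inr (by simpa using hx)
      exact (continuousAt_id.cpow continuousAt_const hmem).tendsto.comp hlim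
    · refine Eventually.of_forall fun ε p => ?_
      have hs := scaleExp_nonneg hα hβ p
      have hΓ : 0 < Real.Gamma (scaleExp α β p + 1) := Real.Gamma_pos_of_pos (by linarith)
      have hE : 0 ≤ expCoeff a b p := by unfold expCoeff; positivity
      have hx' : |x| ≤ ‖(ε : ℂ) + x * Complex.I‖ := by
        simpa using Complex.abs_im_le_norm ((ε : ℂ) + x * Complex.I)
      rw [norm_mul, norm_mul, norm_charCoeff ha.le hb, Complex.norm_real,
        Real.norm_of_nonneg hΓ.le, ← Complex.ofReal_neg, Complex.norm_cpow_real]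
      have := Real.rpow_le_rpow_of_nonpos (abs_pos.mpr hx) hx'
        (by linarith : -(scaleExp α β p + 1) ≤ 0)
      gcongr
  refine tendsto_nhds_unique (hL.congr' ?_) hR
  filter_upwards [self_mem_nhdsWithin] with ε hε
  exact integral_damped_twoScaleChar hα hα' hβ hβ' ha.le hb (by simpa using hε)

/-! ### Real parts and the double series of the density -/

theorem re_exp_mul_cpow_of_pos {x : ℝ} (hx : 0 < x) (s : ℝ) :
    (Complex.exp (-(Complex.I * (Real.pi / 2 * s : ℝ))) *
      (x * Complex.I) ^ (-((s + 1 : ℝ) : ℂ))).re = -(x ^ (-(s + 1)) * Real.sin (Real.pi * s)) := by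
  have h0 : (x * Complex.I : ℂ) ≠ 0 := by simpa using hx.ne'
  rw [Complex.cpow_def_of_ne_zero h0, Complex.log_ofReal_mul hx Complex.I_ne_zero, Complex.log_I,
    ← Complex.exp_add, show -(Complex.I * ((Real.pi / 2 * s : ℝ) : ℂ)) +
      ((Real.log x : ℂ) + Real.pi / 2 * Complex.I) * -((s + 1 : ℝ) : ℂ) =
      ((Real.log x * -(s + 1) : ℝ) : ℂ) + ((-(Real.pi * s + Real.pi / 2) : ℝ) : ℂ) * Complex.I by
        push_cast; ring, Complex.exp_add, ← Complex.ofReal_exp, Complex.re_ofReal_mul,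
    Complex.exp_ofReal_mul_I_re, Real.cos_neg, Real.cos_add_pi_div_two, Real.rpow_def_of_pos hx]
  ring

/-- This is one-sidedness: for x < 0 the argument of ix is -π/2, the phases involving s cancel, and
the remaining phase π/2 has cosine 0. -/
theorem re_exp_mul_cpow_of_neg {x : ℝ} (hx : x < 0) (s : ℝ) :
    (Complex.exp (-(Complex.I * (Real.pi / 2 * s : ℝ))) *
      (x * Complex.I) ^ (-((s + 1 : ℝ) : ℂ))).re = 0 := by
  have h0 : (x * Complex.I : ℂ) ≠ 0 := by simpa using hx.ne
  have h1 : (x * Complex.I : ℂ) = ((-x : ℝ) : ℂ) * -Complex.I := by push_cast; ring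
  rw [Complex.cpow_def_of_ne_zero h0, h1, Complex.log_ofReal_mul (neg_pos.mpr hx)
      (neg_ne_zero.mpr Complex.I_ne_zero), Complex.log_neg_I,
    ← Complex.exp_add, show -(Complex.I * ((Real.pi / 2 * s : ℝ) : ℂ)) +
      ((Real.log (-x) : ℂ) + -(Real.pi / 2) * Complex.I) * -((s + 1 : ℝ) : ℂ) =
      ((Real.log (-x) * -(s + 1) : ℝ) : ℂ) + ((Real.pi / 2 : ℝ) : ℂ) * Complex.I by
        push_cast; ring, Complex.exp_add, ← Complex.ofReal_exp, Complex.re_ofReal_mul,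
    Complex.exp_ofReal_mul_I_re, Real.cos_pi_div_two, mul_zero]

/-- Euler's reflection formula. At integers both sides are 0, as `Real.Gamma` is 0 at its poles. -/
theorem Real.inv_Gamma_neg {s : ℝ} (hs : 0 ≤ s) :
    (Real.Gamma (-s))⁻¹ = -(Real.Gamma (s + 1) * Real.sin (Real.pi * s)) / Real.pi := by
  have hΓ : Real.Gamma (s + 1) ≠ 0 := (Real.Gamma_pos_of_pos (by linarith)).ne'
  have h := Real.Gamma_mul_Gamma_one_sub (-s)
  rw [sub_neg_eq_add, add_comm, mul_neg, Real.sin_neg] at h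
  rw [eq_div_of_mul_eq hΓ h, inv_div, div_div_eq_mul_div, mul_neg]

theorem summable_charCoeff {α β a b : ℝ} (hα : 0 < α) (hα' : α < 1) (hβ : 0 < β)
    (hβ' : β < 1) (ha : 0 ≤ a) (hb : 0 ≤ b) {x : ℝ} (hx : x ≠ 0) :
    Summable fun p => charCoeff α β a b p * ((Real.Gamma (scaleExp α β p + 1) : ℂ) *
        (x * Complex.I) ^ (-((scaleExp α β p + 1 : ℝ) : ℂ))) := by
  refine Summable.of_norm ((summable_expCoeff_mul_Gamma hα hα' hβ hβ' ha hb
    (abs_pos.mpr hx)).congr fun p => ?_)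
  have hΓ : 0 < Real.Gamma (scaleExp α β p + 1) :=
    Real.Gamma_pos_of_pos (by linarith [scaleExp_nonneg hα hβ p])
  rw [norm_mul, norm_mul, norm_charCoeff ha hb, Complex.norm_real, Real.norm_of_nonneg hΓ.le,
    ← Complex.ofReal_neg, Complex.norm_cpow_real]
  simp

/-- The terms of the double series of the two-scale density. -/
def densityTerm (α β a b x : ℝ) (p : ℕ × ℕ) : ℝ :=
  expCoeff (-a) (-b) p * (x ^ (-(scaleExp α β p + 1)) * (Real.Gamma (-scaleExp α β p))⁻¹)

theorem hasSum_densityTerm {α β a b : ℝ} (hα : 0 < α) (hα' : α < 1) (hβ : 0 < β)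
    (hβ' : β < 1) (ha : 0 < a) (hb : 0 ≤ b) {x : ℝ} (hx : 0 < x) :
    HasSum (fun p => (densityTerm α β a b x p : ℂ)) (invChar (twoScaleChar α β a b) x) := by
  rw [invChar_eq_half (integrable_twoScaleChar hα hα' hβ hβ' ha hb) (twoScaleChar_neg α β a b),
    Complex.hasSum_ofReal, integral_Ioi_twoScaleChar hα hα' hβ hβ' ha hb hx.ne']
  refine ((Complex.hasSum_re (summable_charCoeff hα hα' hβ hβ' ha.le hb
    hx.ne').hasSum).mul_left Real.pi⁻¹).congr_fun fun p => ?_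
  rw [charCoeff, mul_mul_mul_comm, ← Complex.ofReal_mul, Complex.re_ofReal_mul,
    re_exp_mul_cpow_of_pos hx, densityTerm, Real.inv_Gamma_neg (scaleExp_nonneg hα hβ p)]
  ring

theorem invChar_twoScaleChar_of_neg {α β a b : ℝ} (hα : 0 < α) (hα' : α < 1) (hβ : 0 < β)
    (hβ' : β < 1) (ha : 0 < a) (hb : 0 ≤ b) {x : ℝ} (hx : x < 0) :
    invChar (twoScaleChar α β a b) x = 0 := by
  have h := Complex.hasSum_re (summable_charCoeff hα hα' hβ hβ' ha.le hb hx.ne).hasSum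
  rw [← integral_Ioi_twoScaleChar hα hα' hβ hβ' ha hb hx.ne] at h
  rw [invChar_eq_half (integrable_twoScaleChar hα hα' hβ hβ' ha hb) (twoScaleChar_neg α β a b),
    ← h.tsum_eq]
  have e : ∀ p, (charCoeff α β a b p * ((Real.Gamma (scaleExp α β p + 1) : ℂ) *
        (x * Complex.I) ^ (-((scaleExp α β p + 1 : ℝ) : ℂ)))).re = 0 := fun p => by
    rw [charCoeff, mul_mul_mul_comm, ← Complex.ofReal_mul, Complex.re_ofReal_mul,
      re_exp_mul_cpow_of_neg hx, mul_zero]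
  simp only [e, tsum_zero, mul_zero, Complex.ofReal_zero]

/-! ### Fourier inversion and convolution -/

theorem norm_exp_neg_I_mul (y : ℝ) : ‖Complex.exp (-(Complex.I * (y : ℝ)))‖ = 1 := by
  rw [mul_comm Complex.I, ← neg_mul, ← Complex.ofReal_neg, Complex.norm_exp_ofReal_mul_I]

theorem continuous_invChar {φ : ℝ → ℂ} (hφ : Integrable φ) : Continuous (invChar φ) := by
  refine Continuous.mul continuous_const (continuous_of_dominated (bound := fun ω => ‖φ ω‖)
    (fun x => (integrable_exp_mul hφ x).aestronglyMeasurable) (fun x => ?_) hφ.norm ?_)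
  · exact Eventually.of_forall fun ω => by rw [norm_mul, norm_exp_neg_I_mul, one_mul]
  · exact Eventually.of_forall fun ω => by fun_prop

theorem fourier_eq_invChar (φ : ℝ → ℂ) (y : ℝ) :
    FourierTransform.fourier φ y = (2 * Real.pi : ℝ) * invChar φ (2 * Real.pi * y) := by
  rw [invChar, mul_inv_cancel_left₀ (by exact_mod_cast Real.two_pi_pos.ne'),
    Real.fourier_real_eq_integral_exp_smul]
  congr 1
  funext v
  rw [smul_eq_mul]
  congr 2
  push_cast
  ring

theorem integral_exp_mul_invChar {φ : ℝ → ℂ} (hc : Continuous φ) (hφ : Integrable φ)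
    (hv : Integrable (invChar φ)) (ω : ℝ) :
    ∫ y : ℝ, Complex.exp (Complex.I * (ω * y : ℝ)) * invChar φ y = φ ω := by
  have hF : Integrable (FourierTransform.fourier φ) := by
    rw [show FourierTransform.fourier φ = _ from funext (fourier_eq_invChar φ)]
    exact (hv.comp_mul_left' Real.two_pi_pos.ne').const_mul _
  have h := congrFun (hc.fourierInv_fourier_eq hφ hF) ω
  rw [Real.fourierInv_eq'] at h
  have e := Measure.integral_comp_mul_left
    (fun y : ℝ => Complex.exp (Complex.I * (ω * y : ℝ)) * invChar φ y) (2 * Real.pi)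
  rw [abs_of_pos (inv_pos.mpr Real.two_pi_pos), Complex.real_smul, Complex.ofReal_inv] at e
  rw [← h, ← mul_right_inj' (a := (((2 * Real.pi : ℝ) : ℂ))⁻¹)
    (inv_ne_zero (by exact_mod_cast Real.two_pi_pos.ne')), ← e, ← integral_const_mul]
  congr 1
  funext v
  rw [fourier_eq_invChar, smul_eq_mul, mul_left_comm (Complex.exp (_ * Complex.I)),
    inv_mul_cancel_left₀
    (by exact_mod_cast Real.two_pi_pos.ne')]
  congr 2
  simp only [RCLike.inner_apply, conj_trivial]
  push_cast
  ring

/-- Write the second factor as an integral over ω and exchange; the inner integral over y is then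
φ(ω) by inversion. Only the first density has to be integrable. -/
theorem integral_invChar_mul_invChar {φ ψ : ℝ → ℂ} (hc : Continuous φ) (hφ : Integrable φ)
    (hv : Integrable (invChar φ)) (hψ : Integrable ψ) (x : ℝ) :
    ∫ y : ℝ, invChar φ y * invChar ψ (x - y) = invChar (fun ω => φ ω * ψ ω) x := by
  have hI : Integrable (Function.uncurry fun y ω : ℝ => invChar φ y *
      (Complex.exp (-(Complex.I * (ω * (x - y) : ℝ))) * ψ ω)) (volume.prod volume) := by
    have h := (hv.mul_prod hψ).bdd_mul (c := 1)
      (f := fun z : ℝ × ℝ => Complex.exp (-(Complex.I * (z.2 * (x - z.1) : ℝ))))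
      (by fun_prop) (Eventually.of_forall fun z => (norm_exp_neg_I_mul _).le)
    refine h.congr (Eventually.of_forall fun z => ?_)
    simp only [Function.uncurry]
    ring
  have e : ∀ y, invChar φ y * invChar ψ (x - y) = ((2 * Real.pi : ℝ) : ℂ)⁻¹ *
      ∫ ω : ℝ, invChar φ y * (Complex.exp (-(Complex.I * (ω * (x - y) : ℝ))) * ψ ω) := fun y => by
    rw [integral_const_mul, mul_left_comm]
    rfl
  simp only [e]
  rw [integral_const_mul, integral_integral_swap hI, invChar]
  congr 2
  funext ω
  rw [← integral_exp_mul_invChar hc hφ hv ω, ← integral_mul_const, ← integral_const_mul]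
  congr 1
  funext y
  rw [show -(Complex.I * ((ω * (x - y) : ℝ) : ℂ)) =
    -(Complex.I * ((ω * x : ℝ) : ℂ)) + Complex.I * ((ω * y : ℝ) : ℂ) by push_cast; ring,
    Complex.exp_add]
  ring

/-! ### One-sidedness and decay of a single density -/

/-- Setting the second time to 0 makes a single stable law a special case; this is why the results
above allow b = 0. -/
theorem stableChar_eq_twoScaleChar (α t : ℝ) : stableChar α t = twoScaleChar α α t 0 := by
  funext ω
  rw [twoScaleChar, stableChar_zero_left, mul_one]

theorem invChar_stableChar_of_neg {α t : ℝ} (h0 : 0 < α) (h1 : α < 1) (ht : 0 < t) {x : ℝ}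
    (hx : x < 0) : invChar (stableChar α t) x = 0 := by
  rw [stableChar_eq_twoScaleChar]
  exact invChar_twoScaleChar_of_neg h0 h1 h0 h1 ht le_rfl hx

theorem oneSidedDensity_eq_invChar {α t : ℝ} (h0 : 0 < α) (h1 : α < 1) (ht : 0 < t) (x : ℝ) :
    (oneSidedDensity α t x : ℂ) = invChar (stableChar α t) x := by
  rw [oneSidedDensity_eq_re,
    invChar_eq_half (integrable_stableChar h0 h1 ht) (stableChar_neg α t), Complex.ofReal_re]

theorem continuous_oneSidedDensity {α t : ℝ} (h0 : 0 < α) (h1 : α < 1) (ht : 0 < t) :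
    Continuous (oneSidedDensity α t) := by
  rw [funext (oneSidedDensity_eq_re α t)]
  exact Complex.continuous_re.comp (continuous_invChar (integrable_stableChar h0 h1 ht))

/-- Only n = 0 survives, and k = 0 drops out because 1/Γ(0) = 0. The slowest remaining power is k =
1, which gives a tail integrable at infinity. -/
theorem abs_densityTerm_le {α t : ℝ} (h0 : 0 < α) {x : ℝ} (hx : 1 ≤ x) (p : ℕ × ℕ) :
    |densityTerm α α t 0 x p| ≤ |densityTerm α α t 0 1 p| * x ^ (-(α + 1)) := by
  obtain ⟨k, n⟩ := p
  have hx0 : 0 < x := one_pos.trans_le hx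
  rcases Nat.eq_zero_or_pos n with rfl | hn
  · rcases Nat.eq_zero_or_pos k with rfl | hk
    · simp [densityTerm, scaleExp, Real.Gamma_zero]
    · have hk' : (1 : ℝ) ≤ k := by exact_mod_cast hk
      have : x ^ (-(scaleExp α α (k, 0) + 1)) ≤ x ^ (-(α + 1)) := by
        refine Real.rpow_le_rpow_of_exponent_le hx ?_
        simp only [scaleExp]
        push_cast
        nlinarith
      rw [densityTerm, densityTerm, Real.one_rpow, one_mul, abs_mul, abs_mul, abs_mul,
        abs_of_pos (Real.rpow_pos_of_pos hx0 _)]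
      have h := mul_le_mul_of_nonneg_left this (mul_nonneg (abs_nonneg (expCoeff (-t) (-0) (k, 0)))
        (abs_nonneg (Real.Gamma (-scaleExp α α (k, 0)))⁻¹))
      linarith
  · simp [densityTerm, expCoeff, hn.ne']

theorem exists_norm_invChar_stableChar_le {α t : ℝ} (h0 : 0 < α) (h1 : α < 1) (ht : 0 < t) :
    ∃ C, ∀ x : ℝ, 1 ≤ x → ‖invChar (stableChar α t) x‖ ≤ C * x ^ (-(α + 1)) := by
  rw [stableChar_eq_twoScaleChar]
  have hsum := fun (x : ℝ) (hx : 0 < x) => hasSum_densityTerm h0 h1 h0 h1 ht le_rfl hx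
  have h1' := (hsum 1 one_pos).summable.norm
  simp only [Complex.norm_real, Real.norm_eq_abs] at h1'
  refine ⟨∑' p, |densityTerm α α t 0 1 p|, fun x hx => ?_⟩
  rw [← (hsum x (one_pos.trans_le hx)).tsum_eq, ← tsum_mul_right]
  refine tsum_of_norm_bounded (h1'.mul_right _).hasSum fun p => ?_
  rw [Complex.norm_real]
  exact abs_densityTerm_le h0 hx p

theorem integrable_invChar_stableChar {α t : ℝ} (h0 : 0 < α) (h1 : α < 1) (ht : 0 < t) :
    Integrable (invChar (stableChar α t)) := by
  have hc := continuous_invChar (integrable_stableChar h0 h1 ht)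
  obtain ⟨C, hC⟩ := exists_norm_invChar_stableChar_le h0 h1 ht
  have hneg : IntegrableOn (invChar (stableChar α t)) (Iio 0) :=
    integrableOn_zero.congr_fun (fun x hx => (invChar_stableChar_of_neg h0 h1 ht hx).symm)
      measurableSet_Iio
  have hmid : IntegrableOn (invChar (stableChar α t)) (Icc 0 1) :=
    hc.continuousOn.integrableOn_compact isCompact_Icc
  have htop : IntegrableOn (invChar (stableChar α t)) (Ioi 1) := by
    refine Integrable.mono' ((integrableOn_Ioi_rpow_of_lt (by linarith : -(α + 1) < -1)
      one_pos).const_mul C) hc.aestronglyMeasurable ?_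
    exact (ae_restrict_iff' measurableSet_Ioi).mpr
      (Eventually.of_forall fun x hx => hC x (le_of_lt hx))
  rw [← integrableOn_univ, ← Iio_union_Ici (a := (0 : ℝ)), ← Icc_union_Ioi_eq_Ici zero_le_one]
  exact hneg.union (hmid.union htop)

theorem twoScaleDensity_eq_invChar {α β t x : ℝ} (hα : 0 < α) (hα' : α < 1) (hβ : 0 < β)
    (hβ' : β < 1) (ht : 0 < t) (hx : 0 < x) :
    (twoScaleDensity α β t x : ℂ) = invChar (twoScaleChar α β t t) x := by
  have h := integral_invChar_mul_invChar (continuous_stableChar hα t)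
    (integrable_stableChar hα hα' ht) (integrable_invChar_stableChar hα hα' ht)
    (integrable_stableChar hβ hβ' ht) x
  rw [show twoScaleChar α β t t = fun ω => stableChar α t ω * stableChar β t ω from rfl, ← h,
    twoScaleDensity, intervalIntegral.integral_of_le hx.le, ← integral_Icc_eq_integral_Ioc,
    ← integral_complex_ofReal]
  -- The interval is closed because the densities are known to vanish only at strictly negative
  -- arguments.
  refine Eq.trans ?_ (setIntegral_eq_integral_of_forall_compl_eq_zero (s := Icc 0 x) ?_)
  · congr 1
    funext y
    rw [Complex.ofReal_mul, oneSidedDensity_eq_invChar hα hα' ht,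
      oneSidedDensity_eq_invChar hβ hβ' ht]
  · intro y hy
    rcases lt_or_ge y 0 with h0 | h0
    · rw [invChar_stableChar_of_neg hα hα' ht h0, zero_mul]
    · have : x - y < 0 := by
        by_contra hxy
        exact hy ⟨h0, by linarith⟩
      rw [invChar_stableChar_of_neg hβ hβ' ht this, mul_zero]

/-! ### Even and odd indices: the confluent series -/

/-- For 1/Γ the recurrence has no exceptional points, so the poles at -r/3 with 3 ∣ r need no
separate treatment. -/
theorem Real.inv_Gamma_eq_mul_inv_Gamma_add_one (z : ℝ) :
    (Real.Gamma z)⁻¹ = z * (Real.Gamma (z + 1))⁻¹ := by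
  rcases eq_or_ne z 0 with rfl | hz
  · simp [Real.Gamma_zero]
  · rw [Real.Gamma_add_one hz, mul_inv, mul_inv_cancel_left₀ hz]

theorem inv_Gamma_neg_add_natCast (s : ℝ) (m : ℕ) :
    (((Real.Gamma (-(s + m)))⁻¹ : ℝ) : ℂ) =
      (ascPochhammer ℂ m).eval ((s : ℂ) + 1) * (-1) ^ m * ((Real.Gamma (-s))⁻¹ : ℝ) := by
  induction m with
  | zero => simp
  | succ m ih =>
    rw [Real.inv_Gamma_eq_mul_inv_Gamma_add_one,
      show -(s + ((m + 1 : ℕ) : ℝ)) + 1 = -(s + m) by push_cast; ring, Complex.ofReal_mul, ih,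
      ascPochhammer_succ_eval, pow_succ]
    push_cast
    ring

theorem rpow_mul_inv_Gamma_neg_add_natCast {x : ℝ} (hx : 0 < x) (s : ℝ) (m : ℕ) :
    ((x ^ (-((s + m) + 1)) * (Real.Gamma (-(s + m)))⁻¹ : ℝ) : ℂ) =
      ((x ^ (-s - 1) * (Real.Gamma (-s))⁻¹ : ℝ) : ℂ) *
        ((ascPochhammer ℂ m).eval ((s : ℂ) + 1) * ((-1) ^ m / (x : ℂ) ^ m)) := by
  rw [Complex.ofReal_mul, inv_Gamma_neg_add_natCast,
    show -((s + m) + 1) = (-s - 1) - (m : ℝ) by ring, Real.rpow_sub_natCast hx.ne']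
  push_cast
  ring

/-- Supplies the lower parameter 1/2 and the 4 in the argument -t²/(4x); the odd analogue supplies
3/2. -/
theorem factorial_two_mul_eq (m : ℕ) :
    ((2 * m).factorial : ℂ) = 4 ^ m * m.factorial * (ascPochhammer ℂ m).eval (1 / 2) := by
  induction m with
  | zero => simp
  | succ m ih =>
    rw [show 2 * (m + 1) = 2 * m + 1 + 1 by ring, Nat.factorial_succ, Nat.factorial_succ,
      Nat.factorial_succ, ascPochhammer_succ_eval, Nat.cast_mul, Nat.cast_mul, ih]
    push_cast
    ring

theorem factorial_two_mul_add_one_eq (m : ℕ) :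
    ((2 * m + 1).factorial : ℂ) = 4 ^ m * m.factorial * (ascPochhammer ℂ m).eval (3 / 2) := by
  induction m with
  | zero => simp
  | succ m ih =>
    rw [show 2 * (m + 1) + 1 = (2 * m + 1) + 1 + 1 by ring, Nat.factorial_succ (_ + 1),
      Nat.factorial_succ (2 * m + 1), Nat.factorial_succ m, ascPochhammer_succ_eval, Nat.cast_mul,
      Nat.cast_mul, ih]
    push_cast
    ring

theorem one_half_ne_neg_natCast (m : ℕ) : (1 / 2 : ℂ) ≠ -m := fun h => by
  have := congrArg Complex.re h
  norm_num at this
  linarith [(Nat.cast_nonneg m : (0 : ℝ) ≤ m)]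

theorem three_halves_ne_neg_natCast (m : ℕ) : (3 / 2 : ℂ) ≠ -m := fun h => by
  have := congrArg Complex.re h
  norm_num at this
  linarith [(Nat.cast_nonneg m : (0 : ℝ) ≤ m)]

/-- Here s = n/3 + m, so increasing m shifts Γ by integers and yields the upper Pochhammer symbol;
odd indices start from n/3 + 1/2 instead. -/
theorem densityTerm_even {t x : ℝ} (hx : 0 < x) (n m : ℕ) :
    (densityTerm (1 / 2) (1 / 3) t t x (2 * m, n) : ℂ) =
      (((-t) ^ n / (n.factorial : ℝ) * x ^ (-((n : ℝ) / 3) - 1) *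
        (Real.Gamma (-((n : ℝ) / 3)))⁻¹ : ℝ) : ℂ) *
      oneFOneTerm (1 + (n : ℂ) / 3) (1 / 2) ((-(t ^ 2 / (4 * x)) : ℝ) : ℂ) m := by
  have hx' : (x : ℂ) ≠ 0 := by exact_mod_cast hx.ne'
  have hp := ascPochhammer_eval_ne_zero one_half_ne_neg_natCast m
  have hm : (m.factorial : ℂ) ≠ 0 := by exact_mod_cast m.factorial_ne_zero
  have hn : (n.factorial : ℂ) ≠ 0 := by exact_mod_cast n.factorial_ne_zero
  have hs : scaleExp (1 / 2) (1 / 3) (2 * m, n) = (n : ℝ) / 3 + m := by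
    simp only [scaleExp]
    push_cast
    ring
  rw [densityTerm, hs, Complex.ofReal_mul, rpow_mul_inv_Gamma_neg_add_natCast hx, oneFOneTerm,
    expCoeff]
  simp only [Complex.ofReal_mul, Complex.ofReal_div, Complex.ofReal_pow, Complex.ofReal_natCast,
    Complex.ofReal_neg, Complex.ofReal_ofNat, factorial_two_mul_eq, neg_pow (_ / _ : ℂ) m, div_pow,
    mul_pow, pow_mul, neg_sq]
  rw [add_comm (1 : ℂ)]
  field_simp

theorem densityTerm_odd {t x : ℝ} (hx : 0 < x) (n m : ℕ) :
    (densityTerm (1 / 2) (1 / 3) t t x (2 * m + 1, n) : ℂ) =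
      (((-t) ^ (n + 1) / (n.factorial : ℝ) * x ^ (-((n : ℝ) / 3) - 3 / 2) *
        (Real.Gamma (-((n : ℝ) / 3) - 1 / 2))⁻¹ : ℝ) : ℂ) *
      oneFOneTerm ((n : ℂ) / 3 + 3 / 2) (3 / 2) ((-(t ^ 2 / (4 * x)) : ℝ) : ℂ) m := by
  have hx' : (x : ℂ) ≠ 0 := by exact_mod_cast hx.ne'
  have hp := ascPochhammer_eval_ne_zero three_halves_ne_neg_natCast m
  have hm : (m.factorial : ℂ) ≠ 0 := by exact_mod_cast m.factorial_ne_zero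
  have hn : (n.factorial : ℂ) ≠ 0 := by exact_mod_cast n.factorial_ne_zero
  have hs : scaleExp (1 / 2) (1 / 3) (2 * m + 1, n) = ((n : ℝ) / 3 + 1 / 2) + m := by
    simp only [scaleExp]
    push_cast
    ring
  have ha : (((n : ℝ) / 3 + 1 / 2 : ℝ) : ℂ) + 1 = (n : ℂ) / 3 + 3 / 2 := by
    push_cast
    ring
  rw [densityTerm, hs, Complex.ofReal_mul, rpow_mul_inv_Gamma_neg_add_natCast hx, oneFOneTerm,
    expCoeff, ha, show -((n : ℝ) / 3 + 1 / 2) - 1 = -((n : ℝ) / 3) - 3 / 2 by ring,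
    show -((n : ℝ) / 3 + 1 / 2) = -((n : ℝ) / 3) - 1 / 2 by ring]
  simp only [Complex.ofReal_mul, Complex.ofReal_div, Complex.ofReal_pow, Complex.ofReal_natCast,
    Complex.ofReal_neg, Complex.ofReal_ofNat, factorial_two_mul_add_one_eq,
    neg_pow (_ / _ : ℂ) m, div_pow, mul_pow, pow_mul, pow_succ _ (2 * m), pow_succ _ n, neg_sq]
  field_simp

theorem hasSum_densityTerm_even {t x : ℝ} (hx : 0 < x) (n : ℕ) :
    HasSum (fun m => (densityTerm (1 / 2) (1 / 3) t t x (2 * m, n) : ℂ)) (confluentTermA t x n) :=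
  ((hasSum_oneFOneTerm one_half_ne_neg_natCast _ _).mul_left _).congr_fun
    fun m => densityTerm_even hx n m

theorem hasSum_densityTerm_odd {t x : ℝ} (hx : 0 < x) (n : ℕ) :
    HasSum (fun m => (densityTerm (1 / 2) (1 / 3) t t x (2 * m + 1, n) : ℂ))
      (confluentTermB t x n) :=
  ((hasSum_oneFOneTerm three_halves_ne_neg_natCast _ _).mul_left _).congr_fun
    fun m => densityTerm_odd hx n m

theorem summable_and_tsum_of_even_odd {f : ℕ × ℕ → ℂ} {S : ℂ} (hf : HasSum f S) {A B : ℕ → ℂ}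
    (hA : ∀ n, HasSum (fun m => f (2 * m, n)) (A n))
    (hB : ∀ n, HasSum (fun m => f (2 * m + 1, n)) (B n)) :
    Summable A ∧ Summable B ∧ S = (∑' n, A n) + ∑' n, B n := by
  have hA' : Summable A := by
    have h := hf.summable.comp_injective (i := fun p : ℕ × ℕ => (2 * p.2, p.1)) (by
      rintro ⟨a, b⟩ ⟨c, d⟩ h
      simp only [Prod.mk.injEq] at h ⊢
      omega)
    exact h.prod.congr fun n => (hA n).tsum_eq
  have hB' : Summable B := by
    have h := hf.summable.comp_injective (i := fun p : ℕ × ℕ => (2 * p.2 + 1, p.1)) (by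
      rintro ⟨a, b⟩ ⟨c, d⟩ h
      simp only [Prod.mk.injEq] at h ⊢
      omega)
    exact h.prod.congr fun n => (hB n).tsum_eq
  -- Fiberwise summation runs over the second coordinate, so the index to be split by parity is
  -- moved there.
  have hswap : HasSum (fun p : ℕ × ℕ => f (p.2, p.1)) S :=
    (Equiv.prodComm ℕ ℕ).hasSum_iff.mpr hf
  have hAB := hswap.prod_fiberwise fun n => (hA n).even_add_odd (hB n)
  exact ⟨hA', hB', hAB.unique (hA'.hasSum.add hB'.hasSum)⟩

/-! ### Parabolic cylinder functions and conclusion -/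

theorem cylinder_constant_fst {x : ℝ} (hx : 0 < x) (n : ℕ) :
    ((Real.sqrt (2 * Real.pi) * x)⁻¹ * (2 * x) ^ (-((n : ℝ) / 3))) *
      ((2 : ℝ) ^ (1 / 2 + (n : ℝ) / 3) * Real.sqrt Real.pi) = x ^ (-((n : ℝ) / 3) - 1) := by
  have h2 : Real.sqrt 2 ≠ 0 := by positivity
  have hπ : Real.sqrt Real.pi ≠ 0 := (Real.sqrt_pos.mpr Real.pi_pos).ne'
  have h3 : (2 : ℝ) ^ ((n : ℝ) / 3) ≠ 0 := by positivity
  have hx' := hx.ne'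
  rw [Real.mul_rpow zero_le_two hx.le, Real.rpow_add two_pos, Real.rpow_neg zero_le_two,
    ← Real.sqrt_eq_rpow, Real.sqrt_mul zero_le_two, Real.rpow_sub_one hx']
  field_simp

theorem cylinder_constant_snd {t x : ℝ} (hx : 0 < x) (n : ℕ) :
    ((Real.sqrt (2 * Real.pi) * x)⁻¹ * (2 * x) ^ (-((n : ℝ) / 3))) *
      ((2 : ℝ) ^ (1 / 2 + (n : ℝ) / 3) * (Real.sqrt (2 * Real.pi) * (t / Real.sqrt (2 * x)))) =
      t * x ^ (-((n : ℝ) / 3) - 3 / 2) := by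
  have h2 : Real.sqrt 2 ≠ 0 := by positivity
  have hπ : Real.sqrt (2 * Real.pi) ≠ 0 := (Real.sqrt_pos.mpr Real.two_pi_pos).ne'
  have h3 : (2 : ℝ) ^ ((n : ℝ) / 3) ≠ 0 := by positivity
  have hx' := hx.ne'
  have hsx : Real.sqrt x ≠ 0 := (Real.sqrt_pos.mpr hx).ne'
  rw [Real.mul_rpow zero_le_two hx.le, Real.rpow_add two_pos, Real.rpow_neg zero_le_two,
    ← Real.sqrt_eq_rpow, Real.sqrt_mul zero_le_two x,
    show -((n : ℝ) / 3) - 3 / 2 = -((n : ℝ) / 3) - 1 - 1 / 2 by ring, Real.rpow_sub hx,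
    Real.rpow_sub_one hx', ← Real.sqrt_eq_rpow]
  field_simp

/-- With z = t/√(2x), the prefactor and the e^(-z²/4) inside D combine to e^(-t²/(4x)) = e^(-z²/2),
exactly the factor Kummer's transformation absorbs. -/
theorem const_mul_cylinderTerm {t x : ℝ} (hx : 0 < x) (n : ℕ) :
    ((Real.exp (-(t ^ 2 / (8 * x))) / (Real.sqrt (2 * Real.pi) * x) : ℝ) : ℂ) *
      cylinderTerm t x n = confluentTermA t x n + confluentTermB t x n := by
  have hz : (((t / Real.sqrt (2 * x) : ℝ) : ℂ)) ^ 2 = ((t ^ 2 / (2 * x) : ℝ) : ℂ) := by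
    rw [← Complex.ofReal_pow, div_pow, Real.sq_sqrt (by positivity)]
  have hz4 : (((t / Real.sqrt (2 * x) : ℝ) : ℂ)) ^ 2 / 4 = ((t ^ 2 / (8 * x) : ℝ) : ℂ) := by
    rw [hz]; push_cast; ring
  have hz2 : (((t / Real.sqrt (2 * x) : ℝ) : ℂ)) ^ 2 / 2 = ((t ^ 2 / (4 * x) : ℝ) : ℂ) := by
    rw [hz]; push_cast; ring
  have h2 : (2 : ℂ) ^ ((1 + 2 * (n : ℂ) / 3) / 2) = (((2 : ℝ) ^ (1 / 2 + (n : ℝ) / 3) : ℝ) : ℂ) := by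
    rw [Complex.ofReal_cpow zero_le_two]
    push_cast
    ring_nf
  have hΓ1 : Complex.Gamma ((1 - (1 + 2 * (n : ℂ) / 3)) / 2) =
      (Real.Gamma (-((n : ℝ) / 3)) : ℂ) := by
    rw [← Complex.Gamma_ofReal]
    push_cast
    ring_nf
  have hΓ2 : Complex.Gamma (-((1 + 2 * (n : ℂ) / 3) / 2)) =
      (Real.Gamma (-((n : ℝ) / 3) - 1 / 2) : ℂ) := by
    rw [← Complex.Gamma_ofReal]
    push_cast
    ring_nf
  have hexp : ((Real.exp (-(t ^ 2 / (8 * x))) : ℝ) : ℂ) *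
      Complex.exp (-((t ^ 2 / (8 * x) : ℝ) : ℂ)) = Complex.exp (-((t ^ 2 / (4 * x) : ℝ) : ℂ)) := by
    rw [Complex.ofReal_exp, ← Complex.exp_add]
    push_cast
    ring_nf
  have hK1 := exp_neg_mul_oneFOne one_half_ne_neg_natCast (-((1 + 2 * (n : ℂ) / 3) / 2))
    ((t ^ 2 / (4 * x) : ℝ) : ℂ)
  have hK2 := exp_neg_mul_oneFOne three_halves_ne_neg_natCast ((1 - (1 + 2 * (n : ℂ) / 3)) / 2)
    ((t ^ 2 / (4 * x) : ℝ) : ℂ)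
  rw [show (1 / 2 : ℂ) - -((1 + 2 * (n : ℂ) / 3) / 2) = 1 + (n : ℂ) / 3 by ring] at hK1
  rw [show (3 / 2 : ℂ) - (1 - (1 + 2 * (n : ℂ) / 3)) / 2 = (n : ℂ) / 3 + 3 / 2 by ring] at hK2
  have hc1 := congrArg (fun r : ℝ => (r : ℂ)) (cylinder_constant_fst hx n)
  have hc2 := congrArg (fun r : ℝ => (r : ℂ)) (cylinder_constant_snd (t := t) hx n)
  rw [cylinderTerm, parabolicCylinderD, hz4, hz2, h2, hΓ1, hΓ2, confluentTermA, confluentTermB,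
    Complex.ofReal_neg, ← hK1, ← hK2, ← hexp, div_eq_mul_inv (Real.exp _), pow_succ (-t) n,
    mul_div_right_comm _ (-t)]
  generalize (-t) ^ n / (n.factorial : ℝ) = q at *
  simp only [Complex.ofReal_mul, Complex.ofReal_inv, Complex.ofReal_neg] at hc1 hc2 ⊢
  generalize ((t / Real.sqrt (2 * x) : ℝ) : ℂ) = z at *
  generalize Complex.exp (-((t ^ 2 / (8 * x) : ℝ) : ℂ)) = e at *
  generalize oneFOne (-((1 + 2 * (n : ℂ) / 3) / 2)) (1 / 2) ((t ^ 2 / (4 * x) : ℝ) : ℂ) = F₁ at *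
  generalize oneFOne ((1 - (1 + 2 * (n : ℂ) / 3)) / 2) (3 / 2) ((t ^ 2 / (4 * x) : ℝ) : ℂ) = F₂ at *
  generalize ((Real.exp (-(t ^ 2 / (8 * x))) : ℝ) : ℂ) = E at *
  linear_combination E * e * q * (Real.Gamma (-((n : ℝ) / 3)) : ℂ)⁻¹ * F₁ * hc1 -
    E * e * q * (Real.Gamma (-((n : ℝ) / 3) - 1 / 2) : ℂ)⁻¹ * F₂ * hc2

/-- Summability in ℂ is equivalent to absolute convergence. -/
theorem mainTheorem10 (t x : ℝ) (ht : 0 < t) (hx : 0 < x) :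
    IntervalIntegrable
      (fun y : ℝ => oneSidedDensity (1 / 2) t y * oneSidedDensity (1 / 3) t (x - y))
      MeasureTheory.volume 0 x ∧
    (Summable (cylinderTerm t x) ∧
      (twoScaleDensity (1 / 2) (1 / 3) t x : ℂ) =
        (Real.exp (-(t ^ 2 / (8 * x))) / (Real.sqrt (2 * Real.pi) * x) : ℝ) *
          ∑' n : ℕ, cylinderTerm t x n) ∧
    (Summable (confluentTermA t x) ∧ Summable (confluentTermB t x) ∧
      (twoScaleDensity (1 / 2) (1 / 3) t x : ℂ) =
        (∑' r : ℕ, confluentTermA t x r) + (∑' r : ℕ, confluentTermB t x r)) := by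
  have hsum := hasSum_densityTerm (α := 1 / 2) (β := 1 / 3) (by norm_num) (by norm_num)
    (by norm_num) (by norm_num) ht ht.le hx
  rw [← twoScaleDensity_eq_invChar (by norm_num) (by norm_num) (by norm_num) (by norm_num) ht hx]
    at hsum
  obtain ⟨hA, hB, hAB⟩ := summable_and_tsum_of_even_odd hsum (hasSum_densityTerm_even hx)
    (hasSum_densityTerm_odd hx)
  refine ⟨?_, ⟨?_, ?_⟩, hA, hB, hAB⟩
  · have h1 := continuous_oneSidedDensity (α := 1 / 2) (by norm_num) (by norm_num) ht
    have h2 := continuous_oneSidedDensity (α := 1 / 3) (by norm_num) (by norm_num) ht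
    exact Continuous.intervalIntegrable (h1.mul (h2.comp (continuous_const.sub continuous_id))) _ _
  · have hc : ((Real.exp (-(t ^ 2 / (8 * x))) / (Real.sqrt (2 * Real.pi) * x) : ℝ) : ℂ) ≠ 0 := by
      have := Real.sqrt_pos.mpr Real.two_pi_pos
      exact_mod_cast (by positivity :
        Real.exp (-(t ^ 2 / (8 * x))) / (Real.sqrt (2 * Real.pi) * x) ≠ 0)
    rw [← summable_mul_left_iff hc]
    exact (hA.add hB).congr fun n => (const_mul_cylinderTerm hx n).symm
  · rw [← tsum_mul_left, hAB, ← hA.tsum_add hB]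
    exact tsum_congr fun n => (const_mul_cylinderTerm hx n).symm

end
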